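/- Let $c\ge 3$ and let $w$ be a reduced billiard table word with $c$ runs, that is, the word $$w=(+)^{\varepsilon_1}(-)^{\varepsilon_2}(+)^{\varepsilon_3}(-)^{\varepsilon_4}\cdots$$ in $\{+,-\}$ with exactly $c$ runs of alternating sign, beginning with $+$, where $\varepsilon_i\in\{1,2\}$ for all $i$, $\varepsilon_1=\varepsilon_c=1$, and the length satisfies $\sum_{i=1}^c\varepsilon_i\equiv 1 \pmod 3$. Let $D$ be the alternating long knot diagram obtained from $w$: it is drawn from left to right as a three-strand braid with $c$ crossings, in which the $i$-th run of $w$ contributes the $i$-th crossing according to $$(+)^1\mapsto\sigma_1,\qquad (+)^2\mapsto\sigma_2^{-1},\qquad (-)^1\mapsto\sigma_2^{-1},\qquad (-)^2\mapsto\sigma_1,$$ where the strands are numbered $1,2,3$ from bottom to top, $\sigma_j$ crosses the $j$-th and $(j+1)$-st strands, and in $\sigma_j$ the strand rising from left to right passes over. On the left, strands $2$ and $3$ are joined by an arc and strand $1$ runs off to infinity. On the right, if $c$ is odd, strands $2$ and $3$ are joined and strand $1$ runs off to infinity; if $c$ is even, strands $1$ and $2$ are joined and strand $3$ runs off to infinity.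 Orient $D$. A crossing of $D$ is called vertically-smoothed if its two strands are both oriented upwards or both oriented downwards. The Seifert circles of $D$ are the components obtained when all crossings are smoothed along the orientation, the unbounded (long) component counting as one circle. Then $$\#\{\text{Seifert circles of } D\}\;\le\; 2+\#\{\text{vertically-smoothed crossings of } D\}.$$ -/

import Mathlib

/-- The two letters of a billiard table word: the sign is the slope of the overstrand. -/
inductive BilliardSign where
  | plus
  | minus

/-- The sign of the `i`-th run (runs are numbered from `0`): the word starts with `+` and the signs
of the runs alternate. -/
def runSign (i : ℕ) : BilliardSign :=
  if Even i then BilliardSign.plus else BilliardSign.minus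

/-- The word `(+)^{ε₀} (-)^{ε₁} (+)^{ε₂} ⋯` with `c` runs, as a list of letters. -/
def billiardWord {c : ℕ} (ε : Fin c → ℕ) : List BilliardSign :=
  (List.ofFn fun i : Fin c => List.replicate (ε i) (runSign i)).flatten

/-- `ε` is the sequence of run lengths of a reduced billiard table word: at least three runs, each
of length one or two, the first and the last of length one, and a total number of letters that is
congruent to `1` modulo `3`.  (The word begins with `+` by the definition of `billiardWord`.) -/
structure IsReducedBilliardWord {c : ℕ} (ε : Fin c → ℕ) : Prop where
  three_le : 3 ≤ c
  single_or_double : ∀ i, ε i = 1 ∨ ε i = 2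
  first_single : ∀ i : Fin c, (i : ℕ) = 0 → ε i = 1
  last_single : ∀ i : Fin c, (i : ℕ) + 1 = c → ε i = 1
  length_mod : (billiardWord ε).length ≡ 1 [MOD 3]

/-- A generator or inverse generator of the braid group on three strands.  The crossing involves
the strands at the heights `index` and `index + 1`, among the heights `0, 1, 2` (from bottom to
top); the rising strand is the overstrand if and only if `positive` holds. -/
structure BraidLetter where
  index : Fin 2
  positive : Bool

namespace BraidLetter

/-- `σ₁`, a positive crossing of the two lower strands. -/
def sigmaOne : BraidLetter := ⟨0, true⟩

/-- `σ₂⁻¹`, a negative crossing of the two upper strands. -/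
def sigmaTwoInv : BraidLetter := ⟨1, false⟩

/-- The height of the lower of the two strands that cross. -/
def low (x : BraidLetter) : Fin 3 := x.index.castSucc

/-- The height of the upper of the two strands that cross. -/
def high (x : BraidLetter) : Fin 3 := x.index.succ

end BraidLetter

/-- The crossing that replaces a run of the given sign and length (one or two):
`+ ↦ σ₁`, `++ ↦ σ₂⁻¹`, `- ↦ σ₂⁻¹`, `-- ↦ σ₁`. -/
def runCrossing (s : BilliardSign) (n : ℕ) : BraidLetter :=
  match s with
  | BilliardSign.plus => if n = 1 then BraidLetter.sigmaOne else BraidLetter.sigmaTwoInv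
  | BilliardSign.minus => if n = 1 then BraidLetter.sigmaTwoInv else BraidLetter.sigmaOne

/-- A long link diagram in plat form: a three-strand braid word with `c` letters, read from left to
right.  On the left the bottom strand runs off to infinity and the two upper strands are joined by
an arc.  On the right, the top strand (if `exitsTop` holds) or the bottom strand (if not) runs off
to infinity and the other two strands are joined by an arc. -/
structure LongPlatDiagram (c : ℕ) where
  letter : Fin c → BraidLetter
  exitsTop : Bool

/-- The alternating diagram `D` of the word with run lengths `ε`: each run becomes one crossing; the
long strand leaves on the right at the bottom if the number of crossings is odd, and at the top if
it is even. -/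
def alternatingDiagram {c : ℕ} (ε : Fin c → ℕ) : LongPlatDiagram c where
  letter i := runCrossing (runSign i) (ε i)
  exitsTop := decide (Even c)

namespace LongPlatDiagram

variable {c : ℕ}

/-- The height at which the long strand leaves on the right. -/
def exitHeight (D : LongPlatDiagram c) : Fin 3 := if D.exitsTop then 2 else 0

/-- The height of the strand that the arc on the right joins to the middle strand. -/
def capHeight (D : LongPlatDiagram c) : Fin 3 := if D.exitsTop then 0 else 2

/-- The points of the diagram between crossings: `(j, h)` is the point at height `h` on the vertical
line that has exactly `j` crossings on its left. Crossing `i` lies between the lines `i.castSucc`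
and `i.succ`. -/
abbrev Point (c : ℕ) : Type := Fin (c + 1) × Fin 3

/-- An orientation of the diagram: `rightward p` says that the diagram is traversed from left to
right at the point `p` (otherwise from right to left).  The direction is kept along the rising
and the falling strand of each crossing and along the strand that misses the crossing; it is
reversed by the arcs on the left and on the right; and the two ends of the long strand agree, as
they are joined through infinity. -/
structure LinkOrientation (D : LongPlatDiagram c) where
  rightward : Point c → Bool
  rising : ∀ i : Fin c,
    rightward (i.castSucc, (D.letter i).low) = rightward (i.succ, (D.letter i).high)
  falling : ∀ i : Fin c,
    rightward (i.castSucc, (D.letter i).high) = rightward (i.succ, (D.letter i).low)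
  straight : ∀ (i : Fin c) (h : Fin 3), h ≠ (D.letter i).low → h ≠ (D.letter i).high →
    rightward (i.castSucc, h) = rightward (i.succ, h)
  left_arc : rightward (0, 1) ≠ rightward (0, 2)
  right_arc : rightward (Fin.last c, 1) ≠ rightward (Fin.last c, D.capHeight)
  long_strand : rightward (0, 0) = rightward (Fin.last c, D.exitHeight)

namespace LinkOrientation

variable {D : LongPlatDiagram c}

/-- The rising strand of crossing `i`, from `(i, low)` to `(i + 1, high)`, is traversed from left
to right, that is, upwards. -/
def RisingRightward (o : LinkOrientation D) (i : Fin c) : Prop :=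
  o.rightward (i.castSucc, (D.letter i).low) = true

/-- The falling strand of crossing `i`, from `(i, high)` to `(i + 1, low)`, is traversed from left
to right, that is, downwards. -/
def FallingRightward (o : LinkOrientation D) (i : Fin c) : Prop :=
  o.rightward (i.castSucc, (D.letter i).high) = true

/-- Both strands of the crossing are oriented upwards or both are oriented downwards. -/
def VerticallySmoothed (o : LinkOrientation D) (i : Fin c) : Prop :=
  (o.RisingRightward i ∧ ¬ o.FallingRightward i) ∨ (¬ o.RisingRightward i ∧ o.FallingRightward i)

/-- Both strands of the crossing are oriented to the right or both are oriented to the left. -/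
def HorizontallySmoothed (o : LinkOrientation D) (i : Fin c) : Prop :=
  (o.RisingRightward i ∧ o.FallingRightward i) ∨ (¬ o.RisingRightward i ∧ ¬ o.FallingRightward i)

/-- The arcs of the curves obtained by smoothing every crossing along the orientation, each arc
given by its two end points. -/
inductive SeifertArc (o : LinkOrientation D) : Point c → Point c → Prop
  | straight (i : Fin c) (h : Fin 3) (hl : h ≠ (D.letter i).low) (hh : h ≠ (D.letter i).high) :
      SeifertArc o (i.castSucc, h) (i.succ, h)
  | horizontalLow (i : Fin c) (hi : o.HorizontallySmoothed i) :
      SeifertArc o (i.castSucc, (D.letter i).low) (i.succ, (D.letter i).low)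
  | horizontalHigh (i : Fin c) (hi : o.HorizontallySmoothed i) :
      SeifertArc o (i.castSucc, (D.letter i).high) (i.succ, (D.letter i).high)
  | verticalLeft (i : Fin c) (hi : o.VerticallySmoothed i) :
      SeifertArc o (i.castSucc, (D.letter i).low) (i.castSucc, (D.letter i).high)
  | verticalRight (i : Fin c) (hi : o.VerticallySmoothed i) :
      SeifertArc o (i.succ, (D.letter i).low) (i.succ, (D.letter i).high)
  | leftArc : SeifertArc o (0, 1) (0, 2)
  | rightArc : SeifertArc o (Fin.last c, 1) (Fin.last c, D.capHeight)
  | longStrand : SeifertArc o (0, 0) (Fin.last c, D.exitHeight)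

/-- The graph formed by the arcs of the smoothed diagram; its connected components are the Seifert
circles. -/
def seifertGraph (o : LinkOrientation D) : SimpleGraph (Point c) :=
  SimpleGraph.fromRel o.SeifertArc

/-- The number of Seifert circles (the long component counts as one circle). -/
noncomputable def numSeifertCircles (o : LinkOrientation D) : ℕ :=
  Nat.card o.seifertGraph.ConnectedComponent

/-- The number of vertically-smoothed crossings. -/
noncomputable def numVertical (o : LinkOrientation D) : ℕ :=
  Nat.card {i : Fin c // o.VerticallySmoothed i}

/-- Every crossing is smoothed in exactly one of the two ways. -/
theorem horizontallySmoothed_iff (o : LinkOrientation D) (i : Fin c) :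
    o.HorizontallySmoothed i ↔ ¬ o.VerticallySmoothed i := by
  unfold HorizontallySmoothed VerticallySmoothed
  tauto

end LinkOrientation

/-- The permutation of the heights given by the first `n` letters of the braid. -/
def partialPerm (D : LongPlatDiagram c) : ℕ → Equiv.Perm (Fin 3)
  | 0 => 1
  | n + 1 =>
    if h : n < c then
      Equiv.swap (D.letter ⟨n, h⟩).low (D.letter ⟨n, h⟩).high * D.partialPerm n
    else D.partialPerm n

/-- Orientations exist. -/
theorem nonempty_linkOrientation (D : LongPlatDiagram c) : Nonempty (LinkOrientation D) := by
  have key : ∀ (p : Equiv.Perm (Fin 3)) (b : Bool), ∃ d : Fin 3 → Bool, d 1 ≠ d 2 ∧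
      d (p.symm 1) ≠ d (p.symm (if b then 0 else 2)) ∧ d 0 = d (p.symm (if b then 2 else 0)) := by
    decide
  have hs : ∀ (i : Fin c) (h : Fin 3), (D.partialPerm ((i : ℕ) + 1)).symm h =
      (D.partialPerm i).symm (Equiv.swap (D.letter i).low (D.letter i).high h) := by
    intro i h
    have hi : (i : ℕ) < c := i.2
    simp only [partialPerm, hi, dif_pos, Fin.eta]
    rfl
  obtain ⟨d, h1, h2, h3⟩ := key (D.partialPerm c) D.exitsTop
  exact ⟨{
    rightward := fun q => d ((D.partialPerm q.1).symm q.2)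
    rising := fun i => by simp [hs]
    falling := fun i => by simp [hs]
    straight := fun i h hl hh => by simp [hs, Equiv.swap_apply_of_ne_of_ne hl hh]
    left_arc := h1
    right_arc := by simpa [capHeight] using h2
    long_strand := by simp only [exitHeight]; exact h3 }⟩

end LongPlatDiagram

namespace LongPlatDiagram

namespace LinkOrientation

variable {c : ℕ} {D : LongPlatDiagram c}

/-! A Seifert circle can turn back at its leftmost part only at the arc on the left or at the right
half of a vertical smoothing; the one other possibility is that it is the long component. So the
left end and the vertical smoothings supply 2 + `numVertical` marked points that together meet every
component. This is `exists_reachable_seifertRepresentative`; counting marked points then gives the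
bound. Several of them may lie on one circle, since the arcs closing the diagram on the right can
only merge components, hence an inequality. -/

theorem SeifertArc.reachable {o : LinkOrientation D} {p q : Point c} (h : o.SeifertArc p q) :
    o.seifertGraph.Reachable p q := by
  -- `SimpleGraph.fromRel` discards loops, so an arc with coinciding ends gives no edge.
  by_cases hpq : p = q
  · exact hpq ▸ SimpleGraph.Reachable.refl _
  · exact SimpleGraph.Adj.reachable ((SimpleGraph.fromRel_adj _ _ _).2 ⟨hpq, Or.inl h⟩)

/-- One point for the long strand, one for the arc on the left, and one on the right of each
vertically-smoothed crossing. -/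
def seifertRepresentative (o : LinkOrientation D) :
    Bool ⊕ {i : Fin c // o.VerticallySmoothed i} → Point c
  | Sum.inl false => (0, 0)
  | Sum.inl true => (0, 1)
  | Sum.inr i => (i.1.succ, (D.letter i.1).low)

/-- Travelling to the left from any point along the smoothed diagram, one arrives at the left end
or at the right side of a vertically-smoothed crossing. -/
theorem exists_reachable_seifertRepresentative (o : LinkOrientation D) (j : Fin (c + 1))
    (h : Fin 3) : ∃ r, o.seifertGraph.Reachable (o.seifertRepresentative r) (j, h) := by
  induction j using Fin.induction generalizing h with
  | zero =>
    fin_cases h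
    · exact ⟨Sum.inl false, SimpleGraph.Reachable.refl _⟩
    · exact ⟨Sum.inl true, SimpleGraph.Reachable.refl _⟩
    · exact ⟨Sum.inl true, SeifertArc.leftArc.reachable⟩
  | succ i ih =>
    -- An arc that crosses the column of crossing `i` keeps its height, so the induction hypothesis
    -- is needed at the same `h` only.
    have extend (hi : o.SeifertArc (i.castSucc, h) (i.succ, h)) :
        ∃ r, o.seifertGraph.Reachable (o.seifertRepresentative r) (i.succ, h) :=
      (ih h).imp fun _ hr => hr.trans hi.reachable
    -- A vertical smoothing blocks the way left at two heights, but its right half joins both to the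
    -- new marked point; the third strand passes.
    by_cases hv : o.VerticallySmoothed i
    · by_cases hl : h = (D.letter i).low
      · exact ⟨Sum.inr ⟨i, hv⟩, hl ▸ SimpleGraph.Reachable.refl _⟩
      by_cases hh : h = (D.letter i).high
      · exact ⟨Sum.inr ⟨i, hv⟩, hh ▸ (SeifertArc.verticalRight i hv).reachable⟩
      exact extend (SeifertArc.straight i h hl hh)
    -- Here all three heights continue to the left.
    · have hz := (o.horizontallySmoothed_iff i).2 hv
      by_cases hl : h = (D.letter i).low
      · exact extend (hl ▸ SeifertArc.horizontalLow i hz)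
      by_cases hh : h = (D.letter i).high
      · exact extend (hh ▸ SeifertArc.horizontalHigh i hz)
      exact extend (SeifertArc.straight i h hl hh)

/-- Every plat diagram on three strands has at most two more Seifert circles than
vertically-smoothed crossings. -/
theorem numSeifertCircles_le (o : LinkOrientation D) :
    o.numSeifertCircles ≤ 2 + o.numVertical := by
  have hsurj : Function.Surjective fun r =>
      o.seifertGraph.connectedComponentMk (o.seifertRepresentative r) := by
    intro C
    induction C using SimpleGraph.ConnectedComponent.ind with
    | h p =>
      obtain ⟨r, hr⟩ := o.exists_reachable_seifertRepresentative p.1 p.2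
      exact ⟨r, SimpleGraph.ConnectedComponent.sound hr⟩
  have hcard := Nat.card_le_card_of_surjective _ hsurj
  -- The constant 2 is the cardinality of `Bool`: the long strand and the left arc.
  rw [Nat.card_sum, Nat.card_eq_fintype_card (α := Bool), Fintype.card_bool] at hcard
  exact hcard

end LinkOrientation

end LongPlatDiagram

theorem mainTheorem4 {c : ℕ} (ε : Fin c → ℕ) (hε : IsReducedBilliardWord ε)
    (o : (alternatingDiagram ε).LinkOrientation) :
    o.numSeifertCircles ≤ 2 + o.numVertical :=
  o.numSeifertCircles_le
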